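/- Let $1\le p\le\infty$ with conjugate exponent $p^*$, let $\mathbb K=\mathbb R$ or $\mathbb C$, let $X$ be a metric space with a distinguished point $0$, let $E$ be a Banach space over $\mathbb K$, and let $T:X\to E$ be a Lipschitz map with $T(0)=0$. Notation. $X^{\#}$ is the space of Lipschitz functions $f:X\to\mathbb K$ with $f(0)=0$, normed by the Lipschitz constant, and $B_{X^{\#}}$ is its closed unit ball. For $x,y\in X$ let $\delta_{(x,y)}\in (X^{\#})^*$, $\delta_{(x,y)}(f)=f(x)-f(y)$. $\mathcal F(X)$ is the closed linear span of the $\delta_{(x,y)}$ in $(X^{\#})^*$, and $B_{X^{\#}}$ carries the (compact) weak* topology given by the duality $X^{\#}=\mathcal F(X)^*$. $\widehat T:\mathcal F(X)\to E$ is the unique continuous linear map with $\widehat T(\delta_{(x,0)})=T(x)$ for all $x$. For a Banach space $F$ and $e_1,\dots,e_n\in F$ put $\|(e_i)\|_{p}=(\sum_i\|e_i\|^p)^{1/p}$ and $\|(e_i)\|_{p,w}=\sup_{\|\varphi\|_{F^*}\le1}\|(\varphi(e_i))\|_{p}$ (maxima instead of sums if $p=\infty$). A continuous linear $R:F\to E$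 is $p$-summing if there is $C>0$ with $\|(R e_i)\|_{p}\le C\|(e_i)\|_{p,w}$ for all finite families $(e_i)$ in $F$. $X\boxtimes E^*$ is the linear span of the functionals $\delta_{(x,y)}\boxtimes s: g\mapsto\langle g(x)-g(y),s\rangle$ ($x,y\in X$, $s\in E^*$) on the space of Lipschitz maps $g:X\to E^{**}$ with $g(0)=0$. For $u\in X\boxtimes E^*$, $$d_p^L(u)=\inf\Big\{\|(m_i)\|_{p,w}\,\|(e_i^*)\|_{p^*}\Big\},$$ the infimum over all finite families $m_i\in\mathcal F(X)$, $e_i^*\in E^*$ such that $\sum_i m_i\otimes e_i^*=\sum_k\delta_{(x_k,y_k)}\otimes s_k$ in $\mathcal F(X)\otimes E^*$ for some representation $u=\sum_k\delta_{(x_k,y_k)}\boxtimes s_k$. $T$ is strictly Lipschitz $p$-summing if there is $C>0$ such that for all finite families $x_k,y_k\in X$, $s_k^*\in E^*$, $$\Big|\sum_k\langle T(x_k)-T(y_k),s_k^*\rangle\Big|\le C\,d_p^L\Big(\sum_k\delta_{(x_k,y_k)}\boxtimes s_k^*\Big).$$ Theorem. Consider the following properties. (1) $T$ is strictly Lipschitz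 $p$-summing. (2) $\widehat T$ is $p$-summing. (3) There are $C>0$ and a Radon probability $\mu$ on $B_{X^{\#}}$ such that for all $n$, all $x^j,y^j\in X$ and $\lambda^j\in\mathbb K$ ($1\le j\le n$), $$\Big\|\sum_{j=1}^n\lambda^j\big(T(x^j)-T(y^j)\big)\Big\|\le C\Big(\int_{B_{X^{\#}}}\Big|\sum_{j=1}^n\lambda^j\big(f(x^j)-f(y^j)\big)\Big|^p d\mu(f)\Big)^{1/p}$$ (for $p=\infty$ the right-hand side is $C$ times the norm in $L^\infty(\mu)$). (4) There is $C>0$ such that for all $n_1,n_2$, all $x_i^j,y_i^j\in X$ and $\lambda_i^j\in\mathbb K$ ($1\le i\le n_1$, $1\le j\le n_2$), $$\Big(\sum_{i=1}^{n_1}\Big\|\sum_{j=1}^{n_2}\lambda_i^j\big(T(x_i^j)-T(y_i^j)\big)\Big\|^p\Big)^{1/p}\le C\sup_{f\in B_{X^{\#}}}\Big(\sum_{i=1}^{n_1}\Big|\sum_{j=1}^{n_2}\lambda_i^j\big(f(x_i^j)-f(y_i^j)\big)\Big|^p\Big)^{1/p}$$ (maxima over $i$ if $p=\infty$). If $p<\infty$,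 or if $X$ is separable, then (1), (2), (3) and (4) are equivalent. For every $1\le p\le\infty$ and every $X$, (1), (2) and (4) are equivalent, and (3) implies them. -/

import Mathlib

open scoped ENNReal TensorProduct
open MeasureTheory

noncomputable section

namespace StrictLip

universe u v

/-! ### The spaces `Lip₀(X; E)` and `X^#` -/

section LipZero

variable (𝕜 : Type*) [RCLike 𝕜] {X : Type u} [MetricSpace X] (x₀ : X)
  (E : Type v) [NormedAddCommGroup E] [NormedSpace 𝕜 E]

/-- The vector space of Lipschitz functions `X → E` vanishing at the base point `x₀`. -/
def lipSubmodule : Submodule 𝕜 (X → E) where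
  carrier := {f | (∃ K, LipschitzWith K f) ∧ f x₀ = 0}
  zero_mem' := ⟨⟨0, LipschitzWith.const 0⟩, rfl⟩
  add_mem' := by
    rintro f g ⟨⟨K, hf⟩, hf0⟩ ⟨⟨L, hg⟩, hg0⟩
    exact ⟨⟨K + L, hf.add hg⟩, by simp [hf0, hg0]⟩
  smul_mem' := by
    rintro c f ⟨⟨K, hf⟩, hf0⟩
    refine ⟨⟨‖c‖₊ * K, LipschitzWith.of_dist_le_mul fun x y => ?_⟩, by simp [hf0]⟩
    have h := hf.dist_le_mul x y
    rw [dist_eq_norm] at h ⊢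
    simp only [Pi.smul_apply, ← smul_sub, norm_smul, NNReal.coe_mul, coe_nnnorm, mul_assoc]
    gcongr

/-- `Lip₀(X; E)`, as a type of its own: it does not inherit the product topology of `X → E`. -/
def LipZero : Type (max u v) := ↥(lipSubmodule 𝕜 x₀ E)

instance : AddCommGroup (LipZero 𝕜 x₀ E) := inferInstanceAs (AddCommGroup (lipSubmodule 𝕜 x₀ E))

instance : Module 𝕜 (LipZero 𝕜 x₀ E) := inferInstanceAs (Module 𝕜 (lipSubmodule 𝕜 x₀ E))

instance : CoeFun (LipZero 𝕜 x₀ E) (fun _ => X → E) := ⟨fun f => f.1⟩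

/-- The Lipschitz norm `Lip(f)`. -/
instance : Norm (LipZero 𝕜 x₀ E) :=
  ⟨fun f => ⨆ z : {z : X × X // z.1 ≠ z.2}, ‖f z.1.1 - f z.1.2‖ / dist z.1.1 z.1.2⟩

variable {𝕜 x₀ E}

namespace LipZero

theorem norm_def (f : LipZero 𝕜 x₀ E) :
    ‖f‖ = ⨆ z : {z : X × X // z.1 ≠ z.2}, ‖f z.1.1 - f z.1.2‖ / dist z.1.1 z.1.2 := rfl

@[ext] theorem ext {f g : LipZero 𝕜 x₀ E} (h : ∀ x, f x = g x) : f = g :=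
  Subtype.ext (funext h)

@[simp] theorem map_base (f : LipZero 𝕜 x₀ E) : f x₀ = 0 := f.2.2
@[simp] theorem zero_apply (x : X) : (0 : LipZero 𝕜 x₀ E) x = 0 := rfl
@[simp] theorem add_apply (f g : LipZero 𝕜 x₀ E) (x : X) : (f + g) x = f x + g x := rfl
@[simp] theorem smul_apply (c : 𝕜) (f : LipZero 𝕜 x₀ E) (x : X) : (c • f) x = c • f x := rfl

theorem norm_sub_le (f : LipZero 𝕜 x₀ E) (x y : X) : ‖f x - f y‖ ≤ ‖f‖ * dist x y := by
  by_cases h : x = y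
  · simp [h]
  obtain ⟨K, hK⟩ := f.2.1
  have hb : BddAbove (Set.range fun z : {z : X × X // z.1 ≠ z.2} =>
      ‖f z.1.1 - f z.1.2‖ / dist z.1.1 z.1.2) := by
    refine ⟨K, ?_⟩
    rintro _ ⟨z, rfl⟩
    have h1 := hK.dist_le_mul z.1.1 z.1.2
    rw [dist_eq_norm] at h1
    exact (div_le_iff₀ (dist_pos.2 z.2)).2 h1
  exact (div_le_iff₀ (dist_pos.2 h)).1 (le_ciSup hb ⟨(x, y), h⟩)

theorem norm_le (f : LipZero 𝕜 x₀ E) {C : ℝ} (hC : 0 ≤ C)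
    (h : ∀ x y, ‖f x - f y‖ ≤ C * dist x y) : ‖f‖ ≤ C :=
  Real.iSup_le (fun z => (div_le_iff₀ (dist_pos.2 z.2)).2 (h _ _)) hC

theorem norm_nonneg' (f : LipZero 𝕜 x₀ E) : 0 ≤ ‖f‖ :=
  Real.iSup_nonneg fun _ => by positivity

theorem norm_smul_le' (c : 𝕜) (f : LipZero 𝕜 x₀ E) : ‖c • f‖ ≤ ‖c‖ * ‖f‖ := by
  refine norm_le _ (mul_nonneg (norm_nonneg c) (norm_nonneg' f)) fun x y => ?_
  rw [smul_apply, smul_apply, ← smul_sub, norm_smul, mul_assoc]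
  exact mul_le_mul_of_nonneg_left (norm_sub_le f x y) (norm_nonneg c)

theorem core : NormedSpace.Core 𝕜 (LipZero 𝕜 x₀ E) where
  norm_nonneg := norm_nonneg'
  norm_smul c f := by
    refine le_antisymm (norm_smul_le' c f) ?_
    by_cases hc : c = 0
    · simpa [hc] using norm_nonneg' ((0 : 𝕜) • f)
    have h := norm_smul_le' c⁻¹ (c • f)
    rw [smul_smul, inv_mul_cancel₀ hc, one_smul, norm_inv] at h
    have hc' : 0 < ‖c‖ := norm_pos_iff.2 hc
    calc ‖c‖ * ‖f‖ ≤ ‖c‖ * (‖c‖⁻¹ * ‖c • f‖) := by gcongr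
      _ = ‖c • f‖ := by field_simp
  norm_triangle f g := by
    refine norm_le _ (add_nonneg (norm_nonneg' f) (norm_nonneg' g)) fun x y => ?_
    rw [add_apply, add_apply, add_sub_add_comm, add_mul]
    exact (norm_add_le _ _).trans (add_le_add (norm_sub_le f x y) (norm_sub_le g x y))
  norm_eq_zero_iff f := by
    constructor
    · intro h
      ext x
      have := norm_sub_le f x x₀
      rw [h, zero_mul, map_base, sub_zero] at this
      simpa using norm_le_zero_iff.1 this
    · rintro rfl
      exact le_antisymm (norm_le _ le_rfl fun x y => by simp) (norm_nonneg' _)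

instance : NormedAddCommGroup (LipZero 𝕜 x₀ E) := NormedAddCommGroup.ofCore core

instance : NormedSpace 𝕜 (LipZero 𝕜 x₀ E) := NormedSpace.ofCore core

end LipZero

end LipZero

/-! ### Closed linear spans -/

section ClosedSpan

variable (𝕜 : Type*) [RCLike 𝕜] {G : Type*} [NormedAddCommGroup G] [NormedSpace 𝕜 G]

/-- The closed linear span of a subset of a normed space, as a normed space. -/
def ClosedSpan (S : Set G) : Type _ := ↥(Submodule.span 𝕜 S).topologicalClosure

instance (S : Set G) : NormedAddCommGroup (ClosedSpan 𝕜 S) :=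
  inferInstanceAs (NormedAddCommGroup (Submodule.span 𝕜 S).topologicalClosure)

instance (S : Set G) : NormedSpace 𝕜 (ClosedSpan 𝕜 S) :=
  inferInstanceAs (NormedSpace 𝕜 (Submodule.span 𝕜 S).topologicalClosure)

namespace ClosedSpan

variable {𝕜} {S : Set G}

/-- The isometric inclusion of the closed linear span. -/
def incl : ClosedSpan 𝕜 S →ₗᵢ[𝕜] G := (Submodule.span 𝕜 S).topologicalClosure.subtypeₗᵢ

/-- An element of `S`, as an element of the closed linear span. -/
def mk (s : G) (hs : s ∈ S) : ClosedSpan 𝕜 S :=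
  ⟨s, Submodule.le_topologicalClosure _ (Submodule.subset_span hs)⟩

@[simp] theorem incl_mk (s : G) (hs : s ∈ S) : incl (mk s hs : ClosedSpan 𝕜 S) = s := rfl

theorem incl_mem {W : Submodule 𝕜 G} (hW : IsClosed (W : Set G)) (h : S ⊆ W)
    (m : ClosedSpan 𝕜 S) : incl m ∈ W :=
  Submodule.topologicalClosure_minimal _ (Submodule.span_le.2 h) hW m.2

variable {E : Type*} [NormedAddCommGroup E] [NormedSpace 𝕜 E]

theorem ext_of_eqOn {R R' : ClosedSpan 𝕜 S →L[𝕜] E} (h : ∀ s hs, R (mk s hs) = R' (mk s hs)) :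
    R = R' := by
  have hcl : IsClosed (LinearMap.ker (R - R').toLinearMap : Set (ClosedSpan 𝕜 S)) :=
    (R - R').isClosed_ker
  have hspan : ∀ k (hk : k ∈ Submodule.span 𝕜 S), ∃ m : ClosedSpan 𝕜 S,
      m ∈ LinearMap.ker (R - R').toLinearMap ∧ incl m = k := by
    intro k hk
    have : k ∈ (LinearMap.ker (R - R').toLinearMap).map (incl (𝕜 := 𝕜) (S := S)).toLinearMap := by
      refine Submodule.span_le.2 ?_ hk
      intro s hs
      exact ⟨mk s hs, by simp [h s hs], rfl⟩
    exact this
  ext m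
  have hm' : m ∈ closure (LinearMap.ker (R - R').toLinearMap : Set (ClosedSpan 𝕜 S)) := by
    rw [(incl (𝕜 := 𝕜) (S := S)).isometry.isEmbedding.isInducing.closure_eq_preimage_closure_image]
    exact closure_mono (fun k hk => hspan k hk) m.2
  rw [hcl.closure_eq] at hm'
  exact sub_eq_zero.1 hm'

theorem exists_lift [CompleteSpace E] {V : Type*} [NormedAddCommGroup V] [NormedSpace 𝕜 V]
    (J : G →L[𝕜] V) (ι : E →ₗᵢ[𝕜] V) (h : ∀ s ∈ S, ∃ e, ι e = J s) :
    ∃ R : ClosedSpan 𝕜 S →L[𝕜] E, ∀ m, ι (R m) = J (incl m) := by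
  have hcl : IsClosed (LinearMap.range ι.toLinearMap : Set V) := by
    rw [LinearMap.coe_range]
    exact ι.isometry.isClosedEmbedding.isClosed_range
  have hJ : ∀ m : ClosedSpan 𝕜 S, J (incl m) ∈ LinearMap.range ι.toLinearMap := fun m =>
    incl_mem (W := (LinearMap.range ι.toLinearMap).comap J.toLinearMap)
      (hcl.preimage J.continuous) (fun s hs => h s hs) m
  let J' : ClosedSpan 𝕜 S →L[𝕜] LinearMap.range ι.toLinearMap :=
    (J.comp incl.toContinuousLinearMap).codRestrict _ hJ
  refine ⟨(ι.equivRange.symm.toContinuousLinearEquiv : _ →L[𝕜] E).comp J', fun m => ?_⟩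
  exact congrArg Subtype.val (ι.equivRange.apply_symm_apply (J' m))

end ClosedSpan

end ClosedSpan

/-! ### The Lipschitz-free space and the linearization -/

section Free

variable (𝕜 : Type*) [RCLike 𝕜] {X : Type u} [MetricSpace X] (x₀ : X)

/-- The functional `δ_(x,y) : f ↦ f x - f y` on `X^# = Lip₀(X; 𝕜)`. -/
def delta (x y : X) : StrongDual 𝕜 (LipZero 𝕜 x₀ 𝕜) :=
  LinearMap.mkContinuous
    { toFun := fun f => f x - f y
      map_add' := fun f g => by simp only [LipZero.add_apply]; ring
      map_smul' := fun c f => by simp [mul_sub] }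
    (dist x y) fun f => by rw [mul_comm]; exact LipZero.norm_sub_le f x y

/-- The Lipschitz-free space `F(X)`: the closed linear span of the `δ_(x,y)` in `(X^#)*`. -/
abbrev LipFree : Type _ := ClosedSpan 𝕜 (Set.range fun z : X × X => delta 𝕜 x₀ z.1 z.2)

/-- The functional `δ_(x,y)` as an element of `F(X)`. -/
def freeDelta (x y : X) : LipFree 𝕜 x₀ := ClosedSpan.mk (delta 𝕜 x₀ x y) ⟨(x, y), rfl⟩

variable {𝕜 x₀} {E : Type v} [NormedAddCommGroup E] [NormedSpace 𝕜 E]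

/-- The map `E* → X^#`, `e* ↦ e* ∘ T`. -/
def lipTranspose (T : LipZero 𝕜 x₀ E) : StrongDual 𝕜 E →L[𝕜] LipZero 𝕜 x₀ 𝕜 :=
  LinearMap.mkContinuous
    { toFun := fun φ => ⟨fun x => φ (T x), by
        obtain ⟨K, hK⟩ := T.2.1
        exact ⟨⟨_, φ.lipschitz.comp hK⟩, by simp⟩⟩
      map_add' := fun φ ψ => rfl
      map_smul' := fun c φ => rfl }
    ‖T‖ fun φ => by
      refine LipZero.norm_le _ (by positivity) fun x y => ?_
      change ‖φ (T x) - φ (T y)‖ ≤ _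
      rw [← map_sub]
      calc ‖φ (T x - T y)‖ ≤ ‖φ‖ * ‖T x - T y‖ := φ.le_opNorm _
        _ ≤ ‖φ‖ * (‖T‖ * dist x y) := by gcongr; exact LipZero.norm_sub_le T x y
        _ = _ := by ring

theorem freeDelta_eq (x y : X) :
    freeDelta 𝕜 x₀ x y = freeDelta 𝕜 x₀ x x₀ - freeDelta 𝕜 x₀ y x₀ := by
  apply ClosedSpan.incl.injective
  rw [map_sub]
  ext f
  change f x - f y = (f x - f x₀) - (f y - f x₀)
  ring

/-- The bidual extension of `T`, the transpose of `e* ↦ e* ∘ T`. -/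
def lipBitranspose (T : LipZero 𝕜 x₀ E) :
    StrongDual 𝕜 (LipZero 𝕜 x₀ 𝕜) →L[𝕜] StrongDual 𝕜 (StrongDual 𝕜 E) :=
  (ContinuousLinearMap.compL 𝕜 (StrongDual 𝕜 E) (LipZero 𝕜 x₀ 𝕜) 𝕜).flip (lipTranspose T)

theorem lipBitranspose_delta (T : LipZero 𝕜 x₀ E) (x y : X) :
    NormedSpace.inclusionInDoubleDualLi 𝕜 (E := E) (T x - T y) =
      lipBitranspose T (delta 𝕜 x₀ x y) := by
  ext φ
  exact map_sub φ (T x) (T y)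

theorem exists_linearization [CompleteSpace E] (T : LipZero 𝕜 x₀ E) :
    ∃ R : LipFree 𝕜 x₀ →L[𝕜] E, ∀ x y, R (freeDelta 𝕜 x₀ x y) = T x - T y := by
  have h : ∀ s ∈ Set.range (fun z : X × X => delta 𝕜 x₀ z.1 z.2),
      ∃ e, NormedSpace.inclusionInDoubleDualLi 𝕜 (E := E) e = lipBitranspose T s := by
    rintro _ ⟨z, rfl⟩
    exact ⟨_, lipBitranspose_delta T z.1 z.2⟩
  obtain ⟨R, hR⟩ := @ClosedSpan.exists_lift 𝕜 _ (StrongDual 𝕜 (LipZero 𝕜 x₀ 𝕜)) _ _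
    (Set.range fun z : X × X => delta 𝕜 x₀ z.1 z.2) E _ _ _ (StrongDual 𝕜 (StrongDual 𝕜 E)) _ _
    (lipBitranspose T) (NormedSpace.inclusionInDoubleDualLi 𝕜 (E := E)) h
  refine ⟨R, fun x y => (NormedSpace.inclusionInDoubleDualLi 𝕜 (E := E)).injective ?_⟩
  rw [lipBitranspose_delta]
  exact hR _

theorem linearization_ext {R S : LipFree 𝕜 x₀ →L[𝕜] E}
    (h : ∀ x, R (freeDelta 𝕜 x₀ x x₀) = S (freeDelta 𝕜 x₀ x x₀)) : R = S := by
  refine ClosedSpan.ext_of_eqOn ?_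
  rintro _ ⟨z, rfl⟩
  have key : R (freeDelta 𝕜 x₀ z.1 z.2) = S (freeDelta 𝕜 x₀ z.1 z.2) := by
    rw [freeDelta_eq, map_sub, map_sub, h, h]
  exact key

theorem existsUnique_linearization [CompleteSpace E] (T : LipZero 𝕜 x₀ E) :
    ∃! R : LipFree 𝕜 x₀ →L[𝕜] E, ∀ x, R (freeDelta 𝕜 x₀ x x₀) = T x := by
  obtain ⟨R, hR⟩ := exists_linearization T
  have hR' : ∀ x, R (freeDelta 𝕜 x₀ x x₀) = T x := fun x => by
    rw [hR, LipZero.map_base, sub_zero]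
  exact ⟨R, hR', fun S hS => linearization_ext fun x => (hS x).trans (hR' x).symm⟩

/-- The linearization `T̂ : F(X) → E`, the continuous linear map with `T̂ ∘ δ_X = T`. -/
def linearization [CompleteSpace E] (T : LipZero 𝕜 x₀ E) : LipFree 𝕜 x₀ →L[𝕜] E :=
  (existsUnique_linearization T).choose

theorem linearization_apply [CompleteSpace E] (T : LipZero 𝕜 x₀ E) (x : X) :
    linearization T (freeDelta 𝕜 x₀ x x₀) = T x :=
  (existsUnique_linearization T).choose_spec.1 x

end Free

/-! ### Strong and weak `ℓ_p`-norms, `p`-summing linear operators -/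

section Summing

/-- The norm of `ℓ_p^n(E)`; for `p = ∞` it is the maximum norm. -/
def strongNorm {E : Type*} [NormedAddCommGroup E] (p : ℝ≥0∞) {n : ℕ} (e : Fin n → E) : ℝ :=
  ‖WithLp.toLp p e‖

variable (𝕜 : Type*) [RCLike 𝕜] {E : Type*} [NormedAddCommGroup E] [NormedSpace 𝕜 E]
  {F : Type*} [NormedAddCommGroup F] [NormedSpace 𝕜 F]

/-- The norm of `ℓ_p^{n,w}(E)`: the supremum over the closed unit ball of `E*`. -/
def weakNorm (p : ℝ≥0∞) {n : ℕ} (e : Fin n → E) : ℝ :=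
  ⨆ φ : {φ : StrongDual 𝕜 E // ‖φ‖ ≤ 1}, strongNorm p fun i => φ.1 (e i)

variable {𝕜}

/-- `p`-summing continuous linear operators. -/
def IsSumming (p : ℝ≥0∞) (R : E →L[𝕜] F) : Prop :=
  ∃ C : ℝ, 0 < C ∧ ∀ (n : ℕ) (e : Fin n → E),
    strongNorm p (fun i => R (e i)) ≤ C * weakNorm 𝕜 p e

end Summing

/-! ### The Lipschitz tensor product and strictly Lipschitz `p`-summing operators -/

section Strict

variable (𝕜 : Type*) [RCLike 𝕜] {X : Type u} [MetricSpace X] (x₀ : X)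
  (F : Type v) [NormedAddCommGroup F] [NormedSpace 𝕜 F]

variable {F} in
/-- The functional `f ↦ ⟨f x - f y, s⟩` on `Lip₀(X; F*)`. -/
def boxFunctional (x y : X) (s : F) : Module.Dual 𝕜 (LipZero 𝕜 x₀ (StrongDual 𝕜 F)) where
  toFun f := (f x - f y) s
  map_add' f g := by
    simp only [LipZero.add_apply, sub_apply, add_apply]
    ring
  map_smul' c f := by simp [mul_sub]

/-- The Lipschitz tensor product `X ⊠ F`. -/
def lipTensor : Submodule 𝕜 (Module.Dual 𝕜 (LipZero 𝕜 x₀ (StrongDual 𝕜 F))) :=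
  Submodule.span 𝕜 (Set.range fun z : (X × X) × F => boxFunctional 𝕜 x₀ z.1.1 z.1.2 z.2)

variable {F}

/-- The elementary tensor `δ_(x,y) ⊠ s` of `X ⊠ F`. -/
def box (x y : X) (s : F) : lipTensor 𝕜 x₀ F :=
  ⟨boxFunctional 𝕜 x₀ x y s, Submodule.subset_span ⟨((x, y), s), rfl⟩⟩

variable {𝕜 x₀}

/-- `A_u`, for `u ∈ X ⊠ F`: the elements `∑ δ_(x_k,y_k) ⊗ s_k` of the algebraic tensor product
`F(X) ⊗ F`, where `u = ∑ δ_(x_k,y_k) ⊠ s_k`. -/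
def tensorsOver (u : lipTensor 𝕜 x₀ F) : Set (LipFree 𝕜 x₀ ⊗[𝕜] F) :=
  {v | ∃ (l : ℕ) (x y : Fin l → X) (s : Fin l → F),
    u = ∑ k, box 𝕜 x₀ (x k) (y k) (s k) ∧ v = ∑ k, freeDelta 𝕜 x₀ (x k) (y k) ⊗ₜ[𝕜] s k}

/-- The Lipschitz cross-norm `d_p^L(u)`: the infimum of `‖(m_i)‖_{p,w} ‖(e_i)‖_{p*}` over all
`∑ m_i ⊗ e_i ∈ A_u`, with `p*` the conjugate exponent of `p`. -/
def dL (p : ℝ≥0∞) (u : lipTensor 𝕜 x₀ F) : ℝ :=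
  sInf {r | ∃ (n : ℕ) (m : Fin n → LipFree 𝕜 x₀) (e : Fin n → F),
    ∑ i, m i ⊗ₜ[𝕜] e i ∈ tensorsOver u ∧
      r = weakNorm 𝕜 p m * strongNorm (ENNReal.conjExponent p) e}

/-- Strictly Lipschitz `p`-summing operators. -/
def IsStrictlyLipschitzSumming {E : Type*} [NormedAddCommGroup E] [NormedSpace 𝕜 E]
    (p : ℝ≥0∞) (T : LipZero 𝕜 x₀ E) : Prop :=
  ∃ C : ℝ, 0 < C ∧ ∀ (l : ℕ) (x y : Fin l → X) (s : Fin l → StrongDual 𝕜 E),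
    ‖∑ k, s k (T (x k) - T (y k))‖ ≤ C * dL p (∑ k, box 𝕜 x₀ (x k) (y k) (s k))

end Strict

/-! ### The unit ball of `X^#` and the two inequalities -/

section Ball

variable (𝕜 : Type*) [RCLike 𝕜] {X : Type u} [MetricSpace X] (x₀ : X)

/-- The closed unit ball `B_{X^#}`. -/
def LipBall : Type _ := {f : LipZero 𝕜 x₀ 𝕜 // ‖f‖ ≤ 1}

/-- The weak* topology of `B_{X^#}`, from the duality `X^# = F(X)*`. -/
instance : TopologicalSpace (LipBall 𝕜 x₀) :=
  TopologicalSpace.induced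
    (fun (f : LipBall 𝕜 x₀) (m : LipFree 𝕜 x₀) => ClosedSpan.incl m f.1)
    Pi.topologicalSpace

instance : MeasurableSpace (LipBall 𝕜 x₀) := borel _

instance : BorelSpace (LipBall 𝕜 x₀) := ⟨rfl⟩

variable {𝕜 x₀} {E : Type v} [NormedAddCommGroup E] [NormedSpace 𝕜 E]

/-- The domination of `T` by a Radon probability on the compact space `B_{X^#}`, with the norm
of `L^p(μ)` on the right-hand side. -/
def IsDominated (p : ℝ≥0∞) (T : LipZero 𝕜 x₀ E) : Prop :=
  ∃ C : ℝ, 0 < C ∧ ∃ μ : Measure (LipBall 𝕜 x₀), IsProbabilityMeasure μ ∧ μ.Regular ∧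
    ∀ (n : ℕ) (x y : Fin n → X) (c : Fin n → 𝕜),
      ‖∑ j, c j • (T (x j) - T (y j))‖ₑ ≤
        ENNReal.ofReal C *
          eLpNorm (fun f : LipBall 𝕜 x₀ => ∑ j, c j * (f.1 (x j) - f.1 (y j))) p μ

/-- The finite summing inequality. -/
def HasSummingInequality (p : ℝ≥0∞) (T : LipZero 𝕜 x₀ E) : Prop :=
  ∃ C : ℝ, 0 < C ∧ ∀ (n₁ n₂ : ℕ) (x y : Fin n₁ → Fin n₂ → X) (c : Fin n₁ → Fin n₂ → 𝕜),
    strongNorm p (fun i => ∑ j, c i j • (T (x i j) - T (y i j))) ≤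
      C * ⨆ f : LipBall 𝕜 x₀,
        strongNorm p fun i => ∑ j, c i j * (f.1 (x i j) - f.1 (y i j))

end Ball

end StrictLip

end

/-!
The statement is one about the linearization `R : F(X) → E` of `T`, once the duality
`F(X)* = X^#` is known to be isometric (`dualBallEquiv`): the weak `ℓ_p`-norm of a family in `F(X)`
is then a supremum over `B_{X^#}`, and the summing inequality says exactly that `R` is `p`-summing
on families from the span of the `δ_(x,y)`. This span is dense and both sides of the inequality are
continuous in the family, so that `R` is `p`-summing (`isSumming_of_dense`).

Strict `p`-summability is the dual formulation. The number `∑ ⟨T x_k - T y_k, s_k⟩` is the value of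
the functional `u = ∑ δ_(x_k,y_k) ⊠ s_k` at `T`, viewed as a map into `E**`, and hence depends on
`u` alone; if `∑ m_i ⊗ e_i` represents `u`, it equals `∑ ⟨R m_i, e_i⟩`, and Hölder's inequality
bounds it by `‖(R m_i)‖_p ‖(e_i)‖_{p*}`. Conversely, `‖(R m_i)‖_p` is attained at some `(s_i)` in the
unit ball of `ℓ_{p*}(E*)` (`exists_norming_family`), and `∑ m_i ⊗ s_i` represents an element of
`X ⊠ E*` whose `d_p^L` is at most `‖(m_i)‖_{p,w}`.

Integrating the domination inequality gives the summing inequality. The converse for `p < ∞` is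
Pietsch's argument: every finite sum of the functions `f ↦ ‖R m‖^p - C^p |m(f)|^p` is nonpositive
somewhere on the compact space `B_{X^#}`, so the Hahn–Banach and Riesz–Markov–Kakutani theorems
yield a probability that integrates all of them to nonpositive values
(`exists_probability_integral_nonpos`). For `p = ∞` and `X` separable, `B_{X^#}` is compact and
metrizable, and a probability that charges each point of a dense sequence turns the supremum of
`|m(f)|` into a norm in `L^∞`.
-/

namespace StrictLip

/-! ### Strong `ℓ_p`-norms and their duality -/

section Norms

variable {E F : Type*} [NormedAddCommGroup E] [NormedAddCommGroup F] {p : ℝ≥0∞} {n : ℕ}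

theorem strongNorm_eq_sum (hp : 0 < p.toReal) (e : Fin n → E) :
    strongNorm p e = (∑ i, ‖e i‖ ^ p.toReal) ^ (1 / p.toReal) :=
  PiLp.norm_eq_sum hp _

theorem strongNorm_top (e : Fin n → E) : strongNorm ∞ e = ‖e‖ :=
  PiLp.norm_toLp e

theorem strongNorm_one (e : Fin n → E) : strongNorm 1 e = ∑ i, ‖e i‖ :=
  PiLp.norm_eq_of_L1 _

theorem toReal_pos_of_one_le (hp : 1 ≤ p) (hp' : p ≠ ∞) : 0 < p.toReal :=
  ENNReal.toReal_pos (zero_lt_one.trans_le hp).ne' hp'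

theorem strongNorm_nonneg (hp : 1 ≤ p) (e : Fin n → E) : 0 ≤ strongNorm p e :=
  haveI := Fact.mk hp
  norm_nonneg (WithLp.toLp p e)

theorem strongNorm_mono (hp : 1 ≤ p) {e : Fin n → E} {f : Fin n → F} (h : ∀ i, ‖e i‖ ≤ ‖f i‖) :
    strongNorm p e ≤ strongNorm p f := by
  rcases eq_or_ne p ∞ with rfl | hp'
  · rw [strongNorm_top, strongNorm_top]
    exact (pi_norm_le_iff_of_nonneg (norm_nonneg _)).2 fun i => (h i).trans (norm_le_pi_norm f i)
  · have := toReal_pos_of_one_le hp hp'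
    rw [strongNorm_eq_sum this, strongNorm_eq_sum this]
    gcongr with i
    exact h i

theorem strongNorm_add_le (hp : 1 ≤ p) (e f : Fin n → E) :
    strongNorm p (fun i => e i + f i) ≤ strongNorm p e + strongNorm p f :=
  haveI := Fact.mk hp
  norm_add_le (WithLp.toLp p e) (WithLp.toLp p f)

theorem continuous_strongNorm (hp : 1 ≤ p) :
    Continuous (strongNorm p : (Fin n → E) → ℝ) :=
  haveI := Fact.mk hp
  continuous_norm.comp (PiLp.continuous_toLp p fun _ : Fin n => E)

theorem strongNorm_fin_one (hp : 1 ≤ p) (e : Fin 1 → E) : strongNorm p e = ‖e 0‖ := by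
  rcases eq_or_ne p ∞ with rfl | hp'
  · simp [strongNorm_top, Pi.norm_def]
  · have := toReal_pos_of_one_le hp hp'
    rw [strongNorm_eq_sum this, Fin.sum_univ_one, one_div,
      Real.rpow_rpow_inv (norm_nonneg _) this.ne']

variable {𝕜 : Type*} [RCLike 𝕜] [NormedSpace 𝕜 E] [NormedSpace 𝕜 F]

/-- Hölder's inequality for the duality between finite families in `E*` and in `E`. -/
theorem norm_sum_apply_le (hp : 1 ≤ p) (s : Fin n → StrongDual 𝕜 E) (v : Fin n → E) :
    ‖∑ i, s i (v i)‖ ≤ strongNorm p v * strongNorm (ENNReal.conjExponent p) s := by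
  have h0 : ‖∑ i, s i (v i)‖ ≤ ∑ i, ‖v i‖ * ‖s i‖ :=
    (norm_sum_le _ _).trans <| Finset.sum_le_sum fun i _ => by
      rw [mul_comm]
      exact (s i).le_opNorm _
  refine h0.trans ?_
  rcases eq_or_ne p ∞ with rfl | hp'
  · have hc : ENNReal.conjExponent ∞ = 1 := by simp [ENNReal.conjExponent]
    rw [hc, strongNorm_top, strongNorm_one, Finset.mul_sum]
    gcongr with i
    exact norm_le_pi_norm v i
  rcases hp.eq_or_lt with rfl | hp1
  · have hc : ENNReal.conjExponent 1 = ∞ := by simp [ENNReal.conjExponent]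
    rw [hc, strongNorm_top, strongNorm_one, Finset.sum_mul]
    gcongr with i
    exact norm_le_pi_norm s i
  · have h1 : 1 < p.toReal := by
      rwa [← ENNReal.toReal_one, ENNReal.toReal_lt_toReal ENNReal.one_ne_top hp']
    have := ENNReal.HolderConjugate.conjExponent hp
    have hpq : p.toReal.HolderConjugate (ENNReal.conjExponent p).toReal :=
      ENNReal.HolderConjugate.toReal h1
    rw [strongNorm_eq_sum hpq.pos, strongNorm_eq_sum hpq.symm.pos]
    exact Real.inner_le_Lp_mul_Lq_of_nonneg _ hpq (fun _ _ => norm_nonneg _)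
      fun _ _ => norm_nonneg _

/-- The `ℓ_p`-norm of a finite family of scalars is attained by pairing with a nonnegative family
in the unit ball of `ℓ_{p*}`. -/
theorem exists_conj_norming (hp : 1 ≤ p) (v : Fin n → E) :
    ∃ b : Fin n → ℝ, (∀ i, 0 ≤ b i) ∧ strongNorm (ENNReal.conjExponent p) b ≤ 1 ∧
      ∑ i, ‖v i‖ * b i = strongNorm p v := by
  rcases eq_or_ne p ∞ with rfl | hp'
  · have hc : ENNReal.conjExponent ∞ = 1 := by simp [ENNReal.conjExponent]
    rw [hc, strongNorm_top]
    rcases isEmpty_or_nonempty (Fin n) with hn | hn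
    · exact ⟨0, fun _ => le_rfl, by simp [strongNorm_one], by simp [Pi.norm_def]⟩
    obtain ⟨i₀, hi₀⟩ := Finite.exists_max fun i => ‖v i‖
    refine ⟨Pi.single i₀ 1, fun i => by rw [Pi.single_apply]; split_ifs <;> norm_num, ?_, ?_⟩
    · rw [strongNorm_one, Finset.sum_eq_single i₀] <;> simp +contextual
    · have : ‖v‖ = ‖v i₀‖ :=
        le_antisymm ((pi_norm_le_iff_of_nonneg (norm_nonneg _)).2 hi₀) (norm_le_pi_norm v i₀)
      rw [this, Finset.sum_eq_single i₀] <;> simp +contextual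
  rcases hp.eq_or_lt with rfl | hp1
  · have hc : ENNReal.conjExponent 1 = ∞ := by simp [ENNReal.conjExponent]
    refine ⟨fun _ => 1, fun _ => zero_le_one, ?_, by simp [strongNorm_one]⟩
    rw [hc, strongNorm_top]
    exact (pi_norm_le_iff_of_nonneg zero_le_one).2 fun i => by simp
  · have h1 : 1 < p.toReal := by
      rwa [← ENNReal.toReal_one, ENNReal.toReal_lt_toReal ENNReal.one_ne_top hp']
    have := ENNReal.HolderConjugate.conjExponent hp
    have hpq : p.toReal.HolderConjugate (ENNReal.conjExponent p).toReal :=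
      ENNReal.HolderConjugate.toReal h1
    obtain ⟨⟨g, hg, hgv⟩, -⟩ := NNReal.isGreatest_Lp Finset.univ (fun i => ‖v i‖₊) hpq
    refine ⟨fun i => g i, fun i => (g i).2, ?_, ?_⟩
    · rw [strongNorm_eq_sum hpq.symm.pos]
      refine Real.rpow_le_one (by positivity) ?_ (by have := hpq.symm.pos; positivity)
      simp only [NNReal.norm_eq]
      exact_mod_cast hg
    · rw [strongNorm_eq_sum hpq.pos]
      have := congrArg NNReal.toReal hgv
      simpa using this

/-- The dual description of the `ℓ_p(E)`-norm: it is attained on the unit ball of `ℓ_{p*}(E*)`. -/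
theorem exists_norming_family (𝕜 : Type*) [RCLike 𝕜] [NormedSpace 𝕜 E] (hp : 1 ≤ p)
    (v : Fin n → E) :
    ∃ s : Fin n → StrongDual 𝕜 E, strongNorm (ENNReal.conjExponent p) s ≤ 1 ∧
      ∑ i, s i (v i) = (strongNorm p v : 𝕜) := by
  obtain ⟨b, hb0, hb1, hb⟩ := exists_conj_norming hp v
  choose g hg1 hg using fun i => exists_dual_vector'' 𝕜 (v i)
  refine ⟨fun i => (b i : 𝕜) • g i, (strongNorm_mono ?_ fun i => ?_).trans hb1, ?_⟩
  · rw [ENNReal.conjExponent]; exact le_self_add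
  · rw [norm_smul, RCLike.norm_ofReal, Real.norm_eq_abs]
    exact mul_le_of_le_one_right (abs_nonneg _) (hg1 i)
  · rw [← hb]
    push_cast
    exact Finset.sum_congr rfl fun i _ => by simp [hg, mul_comm]

/-! ### Weak `ℓ_p`-norms -/

theorem bddAbove_weakNorm (hp : 1 ≤ p) (e : Fin n → E) :
    BddAbove (Set.range fun φ : {φ : StrongDual 𝕜 E // ‖φ‖ ≤ 1} =>
      strongNorm p fun i => φ.1 (e i)) := by
  refine ⟨strongNorm p e, ?_⟩
  rintro _ ⟨φ, rfl⟩
  exact strongNorm_mono hp fun i => φ.1.le_of_opNorm_le φ.2 (e i) |>.trans_eq (one_mul _)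

theorem le_weakNorm (hp : 1 ≤ p) (e : Fin n → E) {φ : StrongDual 𝕜 E} (hφ : ‖φ‖ ≤ 1) :
    strongNorm p (fun i => φ (e i)) ≤ weakNorm 𝕜 p e :=
  le_ciSup (bddAbove_weakNorm hp e) (⟨φ, hφ⟩ : {φ : StrongDual 𝕜 E // ‖φ‖ ≤ 1})

theorem weakNorm_nonneg (hp : 1 ≤ p) (e : Fin n → E) : 0 ≤ weakNorm 𝕜 p e :=
  Real.iSup_nonneg fun _ => strongNorm_nonneg hp _

theorem weakNorm_le_add (hp : 1 ≤ p) (e f : Fin n → E) :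
    weakNorm 𝕜 p e ≤ weakNorm 𝕜 p f + strongNorm p (fun i => e i - f i) := by
  refine Real.iSup_le (fun φ => ?_) (add_nonneg (weakNorm_nonneg hp f) (strongNorm_nonneg hp _))
  calc strongNorm p (fun i => φ.1 (e i))
      = strongNorm p (fun i => φ.1 (f i) + φ.1 (e i - f i)) := by simp
    _ ≤ strongNorm p (fun i => φ.1 (f i)) + strongNorm p (fun i => φ.1 (e i - f i)) :=
        strongNorm_add_le hp _ _
    _ ≤ _ := add_le_add (le_weakNorm hp f φ.2)
        (strongNorm_mono hp fun i => φ.1.le_of_opNorm_le φ.2 _ |>.trans_eq (one_mul _))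

theorem continuous_weakNorm (hp : 1 ≤ p) :
    Continuous (weakNorm 𝕜 p : (Fin n → E) → ℝ) := by
  have := Fact.mk hp
  have h : LipschitzWith 1 fun e : PiLp p (fun _ : Fin n => E) => weakNorm 𝕜 p e.ofLp :=
    LipschitzWith.of_le_add fun e f => by
      rw [dist_eq_norm]
      exact weakNorm_le_add hp e.ofLp f.ofLp
  exact h.continuous.comp (PiLp.continuous_toLp p fun _ : Fin n => E)

/-- It is enough to test `p`-summability on families from a dense subset. -/
theorem isSumming_of_dense (hp : 1 ≤ p) (R : E →L[𝕜] F) {D : Set E} (hD : Dense D) {C : ℝ}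
    (hC : 0 < C) (h : ∀ (n : ℕ) (e : Fin n → E), (∀ i, e i ∈ D) →
      strongNorm p (fun i => R (e i)) ≤ C * weakNorm 𝕜 p e) :
    IsSumming p R := by
  refine ⟨C, hC, fun n e => ?_⟩
  have hcl : IsClosed {e : Fin n → E | strongNorm p (fun i => R (e i)) ≤ C * weakNorm 𝕜 p e} :=
    isClosed_le ((continuous_strongNorm hp).comp (by fun_prop))
      (continuous_const.mul (continuous_weakNorm hp))
  have hd : Dense (Set.univ.pi fun _ : Fin n => D) := dense_pi _ fun _ _ => hD
  have hsub : (Set.univ.pi fun _ : Fin n => D) ⊆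
      {e : Fin n → E | strongNorm p (fun i => R (e i)) ≤ C * weakNorm 𝕜 p e} :=
    fun e he => h n e fun i => he i trivial
  exact hcl.closure_subset_iff.2 hsub (hd e)

end Norms

/-! ### The duality between `F(X)` and `X^#` -/

section Duality

variable {𝕜 : Type*} [RCLike 𝕜] {X : Type*} [MetricSpace X] {x₀ : X}

@[simp] theorem incl_freeDelta (x y : X) (f : LipZero 𝕜 x₀ 𝕜) :
    ClosedSpan.incl (freeDelta 𝕜 x₀ x y) f = f x - f y := rfl

variable (𝕜 x₀) in
theorem dense_span_freeDelta :
    Dense (Submodule.span 𝕜 (Set.range fun z : X × X => freeDelta 𝕜 x₀ z.1 z.2) :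
      Set (LipFree 𝕜 x₀)) := by
  intro m
  have hincl := (ClosedSpan.incl (𝕜 := 𝕜)
    (S := Set.range fun z : X × X => delta 𝕜 x₀ z.1 z.2)).isometry.isEmbedding.isInducing
  rw [hincl.closure_eq_preimage_closure_image]
  refine closure_mono ?_ m.2
  have : Submodule.span 𝕜 (Set.range fun z : X × X => delta 𝕜 x₀ z.1 z.2) ≤
      (Submodule.span 𝕜 (Set.range fun z : X × X => freeDelta 𝕜 x₀ z.1 z.2)).map
        (ClosedSpan.incl (𝕜 := 𝕜)
          (S := Set.range fun z : X × X => delta 𝕜 x₀ z.1 z.2)).toLinearMap := by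
    rw [Submodule.span_le]
    rintro _ ⟨z, rfl⟩
    exact ⟨freeDelta 𝕜 x₀ z.1 z.2, Submodule.subset_span ⟨z, rfl⟩, rfl⟩
  exact this

/-- Finitely many elements of the span of the `δ_(x,y)` are linear combinations of one common
finite family. -/
theorem exists_common_family {n : ℕ} {m : Fin n → LipFree 𝕜 x₀}
    (hm : ∀ i, m i ∈ Submodule.span 𝕜 (Set.range fun z : X × X => freeDelta 𝕜 x₀ z.1 z.2)) :
    ∃ (l : ℕ) (x y : Fin l → X) (c : Fin n → Fin l → 𝕜),
      ∀ i, m i = ∑ j, c i j • freeDelta 𝕜 x₀ (x j) (y j) := by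
  classical
  choose a ha using fun i => Finsupp.mem_span_range_iff_exists_finsupp.1 (hm i)
  let S : Finset (X × X) := Finset.univ.biUnion fun i => (a i).support
  refine ⟨S.card, fun j => (S.equivFin.symm j).1.1, fun j => (S.equivFin.symm j).1.2,
    fun i j => a i (S.equivFin.symm j).1, fun i => ?_⟩
  rw [← ha i, Finsupp.sum_of_support_subset (a i)
    (Finset.subset_biUnion_of_mem (fun i => (a i).support) (Finset.mem_univ i)) _ (by simp)]
  rw [S.equivFin.symm.sum_comp
    fun z : S => a i z.1 • freeDelta 𝕜 x₀ z.1.1 z.1.2]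
  exact (Finset.sum_coe_sort S fun z => a i z • freeDelta 𝕜 x₀ z.1 z.2).symm

/-- A Lipschitz function, as a functional on `F(X)`. -/
noncomputable def lipEval (f : LipZero 𝕜 x₀ 𝕜) : StrongDual 𝕜 (LipFree 𝕜 x₀) :=
  (ContinuousLinearMap.apply 𝕜 𝕜 f).comp ClosedSpan.incl.toContinuousLinearMap

@[simp] theorem lipEval_apply (f : LipZero 𝕜 x₀ 𝕜) (m : LipFree 𝕜 x₀) :
    lipEval f m = ClosedSpan.incl m f := rfl

theorem norm_lipEval_le (f : LipZero 𝕜 x₀ 𝕜) : ‖lipEval f‖ ≤ ‖f‖ := by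
  refine ContinuousLinearMap.opNorm_le_bound _ (norm_nonneg _) fun m => ?_
  rw [lipEval_apply, mul_comm, ← ClosedSpan.incl.norm_map m]
  exact ContinuousLinearMap.le_opNorm _ _

theorem norm_freeDelta_le (x y : X) : ‖freeDelta 𝕜 x₀ x y‖ ≤ dist x y :=
  LinearMap.mkContinuous_norm_le _ dist_nonneg fun f => by
    rw [mul_comm]; exact LipZero.norm_sub_le f x y

theorem norm_apply_freeDelta_sub_le (φ : StrongDual 𝕜 (LipFree 𝕜 x₀)) (x y : X) :
    ‖φ (freeDelta 𝕜 x₀ x x₀) - φ (freeDelta 𝕜 x₀ y x₀)‖ ≤ ‖φ‖ * dist x y := by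
  rw [← map_sub, ← freeDelta_eq]
  exact (φ.le_opNorm _).trans (by gcongr; exact norm_freeDelta_le x y)

/-- The Lipschitz function `x ↦ φ(δ_(x,0))` of a functional `φ` on `F(X)`. -/
noncomputable def lipOfDual (φ : StrongDual 𝕜 (LipFree 𝕜 x₀)) : LipZero 𝕜 x₀ 𝕜 :=
  ⟨fun x => φ (freeDelta 𝕜 x₀ x x₀),
    ⟨‖φ‖₊, LipschitzWith.of_dist_le_mul fun x y => by
      rw [dist_eq_norm]; exact norm_apply_freeDelta_sub_le φ x y⟩,
    by beta_reduce; rw [freeDelta_eq, sub_self, map_zero]⟩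

theorem norm_lipOfDual_le (φ : StrongDual 𝕜 (LipFree 𝕜 x₀)) : ‖lipOfDual φ‖ ≤ ‖φ‖ :=
  LipZero.norm_le _ (norm_nonneg _) (norm_apply_freeDelta_sub_le φ)

theorem lipEval_lipOfDual (φ : StrongDual 𝕜 (LipFree 𝕜 x₀)) : lipEval (lipOfDual φ) = φ :=
  linearization_ext fun x => by
    change lipOfDual φ x - lipOfDual φ x₀ = _
    rw [LipZero.map_base, sub_zero]
    rfl

theorem lipOfDual_lipEval (f : LipZero 𝕜 x₀ 𝕜) : lipOfDual (lipEval f) = f := by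
  ext x
  change f x - f x₀ = f x
  rw [LipZero.map_base, sub_zero]

variable (𝕜 x₀) in
/-- The closed unit balls of `F(X)*` and of `X^#` are in bijection. -/
noncomputable def dualBallEquiv : {φ : StrongDual 𝕜 (LipFree 𝕜 x₀) // ‖φ‖ ≤ 1} ≃ LipBall 𝕜 x₀ where
  toFun φ := ⟨lipOfDual φ.1, (norm_lipOfDual_le _).trans φ.2⟩
  invFun f := ⟨lipEval f.1, (norm_lipEval_le _).trans f.2⟩
  left_inv φ := Subtype.ext (lipEval_lipOfDual φ.1)
  right_inv f := Subtype.ext (lipOfDual_lipEval f.1)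

theorem weakNorm_eq_iSup_lipBall (p : ℝ≥0∞) {n : ℕ} (m : Fin n → LipFree 𝕜 x₀) :
    weakNorm 𝕜 p m =
      ⨆ f : LipBall 𝕜 x₀, strongNorm p fun i => ClosedSpan.incl (m i) f.1 :=
  ((dualBallEquiv 𝕜 x₀).symm.iSup_congr fun _ => rfl).symm

/-! ### The weak* topology of the unit ball -/

theorem LipBall.isInducing_incl :
    Topology.IsInducing fun (f : LipBall 𝕜 x₀) (m : LipFree 𝕜 x₀) => ClosedSpan.incl m f.1 :=
  ⟨rfl⟩

theorem continuous_lipBall_incl (m : LipFree 𝕜 x₀) :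
    Continuous fun f : LipBall 𝕜 x₀ => ClosedSpan.incl m f.1 :=
  (continuous_apply m).comp LipBall.isInducing_incl.continuous

theorem continuous_lipBall_eval (x : X) : Continuous fun f : LipBall 𝕜 x₀ => f.1 x := by
  simpa using continuous_lipBall_incl (𝕜 := 𝕜) (freeDelta 𝕜 x₀ x x₀)

theorem LipBall.ext {f g : LipBall 𝕜 x₀} (h : ∀ x, f.1 x = g.1 x) : f = g :=
  Subtype.ext (LipZero.ext h)

theorem LipBall.dist_le (f : LipBall 𝕜 x₀) (x y : X) : dist (f.1 x) (f.1 y) ≤ dist x y := by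
  rw [dist_eq_norm]
  exact (LipZero.norm_sub_le f.1 x y).trans (mul_le_of_le_one_left dist_nonneg f.2)

theorem LipBall.continuous (f : LipBall 𝕜 x₀) : Continuous f.1.1 :=
  (LipschitzWith.mk_one f.dist_le).continuous

instance : Nonempty (LipBall 𝕜 x₀) := ⟨⟨0, by simp⟩⟩

instance : T2Space (LipBall 𝕜 x₀) :=
  T2Space.of_injective_continuous (f := fun (f : LipBall 𝕜 x₀) (x : X) => f.1 x)
    (fun _ _ h => LipBall.ext (congrFun h)) (continuous_pi continuous_lipBall_eval)

/-- The Banach–Alaoglu theorem, through the duality `X^# = F(X)*`. -/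
instance : CompactSpace (LipBall 𝕜 x₀) := by
  let K : Set (WeakDual 𝕜 (LipFree 𝕜 x₀)) := WeakDual.toStrongDual ⁻¹' Metric.closedBall 0 1
  have hK : IsCompact K := WeakDual.isCompact_closedBall 0 1
  have : CompactSpace K := isCompact_iff_compactSpace.1 hK
  have hmem : ∀ φ : K, ‖WeakDual.toStrongDual φ.1‖ ≤ 1 := fun φ => mem_closedBall_zero_iff.1 φ.2
  let Φ : K → LipBall 𝕜 x₀ := fun φ => dualBallEquiv 𝕜 x₀ ⟨WeakDual.toStrongDual φ.1, hmem φ⟩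
  have hΦ : Continuous Φ := by
    refine LipBall.isInducing_incl.continuous_iff.2 (continuous_pi fun m => ?_)
    have : (fun φ : K => ClosedSpan.incl m (Φ φ).1) = fun φ : K => φ.1 m := by
      ext φ
      exact congrArg (fun ψ : StrongDual 𝕜 (LipFree 𝕜 x₀) => ψ m) (lipEval_lipOfDual _)
    exact this ▸ (WeakDual.eval_continuous m).comp continuous_subtype_val
  have hsurj : Function.Surjective Φ := fun f =>
    ⟨⟨StrongDual.toWeakDual (lipEval f.1),
      mem_closedBall_zero_iff.2 ((norm_lipEval_le f.1).trans f.2)⟩,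
      (dualBallEquiv 𝕜 x₀).apply_symm_apply f⟩
  exact hsurj.compactSpace hΦ

/-- If `X` is separable, then `B_{X^#}` is metrizable: evaluation on a dense sequence embeds it
into a countable product of lines. -/
theorem metrizableSpace_lipBall [TopologicalSpace.SeparableSpace X] :
    TopologicalSpace.MetrizableSpace (LipBall 𝕜 x₀) := by
  have : Nonempty X := ⟨x₀⟩
  have hcont : Continuous fun (f : LipBall 𝕜 x₀) (n : ℕ) => f.1 (TopologicalSpace.denseSeq X n) :=
    continuous_pi fun n => continuous_lipBall_eval _
  refine (hcont.isClosedEmbedding fun f g h => LipBall.ext ?_).isEmbedding.metrizableSpace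
  exact congrFun ((TopologicalSpace.denseRange_denseSeq X).equalizer f.continuous g.continuous h)

end Duality

/-! ### Separation in `C(K)` -/

section Minimax

variable {K : Type*} [TopologicalSpace K] [CompactSpace K] [T2Space K] [MeasurableSpace K]
  [BorelSpace K]

/-- The Riesz–Markov–Kakutani theorem on a compact space, for functionals on `C(K)`. -/
theorem exists_measure_of_functional (Λ : C(K, ℝ) →ₗ[ℝ] ℝ)
    (hpos : ∀ g : C(K, ℝ), 0 ≤ g → 0 ≤ Λ g) :
    ∃ μ : Measure K, μ.Regular ∧ IsFiniteMeasure μ ∧ ∀ g : C(K, ℝ), ∫ k, g k ∂μ = Λ g := by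
  let L : CompactlySupportedContinuousMap K ℝ →ₚ[ℝ] ℝ :=
    PositiveLinearMap.mk₀
      { toFun := fun g => Λ g.toContinuousMap
        map_add' := fun g h => Λ.map_add g.toContinuousMap h.toContinuousMap
        map_smul' := fun c g => Λ.map_smul c g.toContinuousMap }
      fun g hg => hpos _ fun k => hg k
  have hreg : (RealRMK.rieszMeasure L).Regular := RealRMK.regular_rieszMeasure L
  exact ⟨RealRMK.rieszMeasure L, hreg, inferInstance, fun g =>
    RealRMK.integral_rieszMeasure L (CompactlySupportedContinuousMap.continuousMapEquiv g)⟩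

/-- If a set of continuous functions on a compact space is stable under nonnegative multiples,
and every finite sum of its members is nonpositive somewhere, then some Radon probability
integrates all its members to nonpositive values. -/
theorem exists_probability_integral_nonpos [Nonempty K] {A : Set C(K, ℝ)} (h0 : A.Nonempty)
    (hsmul : ∀ g ∈ A, ∀ t : ℝ, 0 ≤ t → t • g ∈ A)
    (hsum : ∀ (n : ℕ) (g : Fin n → C(K, ℝ)), (∀ i, g i ∈ A) → ∃ k, ∑ i, g i k ≤ 0) :
    ∃ μ : Measure K, IsProbabilityMeasure μ ∧ μ.Regular ∧ ∀ g ∈ A, ∫ k, g k ∂μ ≤ 0 := by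
  let B : Set C(K, ℝ) := {h | ∀ k, 0 < h k}
  have hBconv : Convex ℝ B := by
    intro f hf g hg a b ha hb hab k
    exact convex_Ioi (0 : ℝ) (hf k) (hg k) ha hb hab
  have hBopen : IsOpen B := by
    have : B = {h : C(K, ℝ) | Set.MapsTo h Set.univ (Set.Ioi 0)} := by
      ext h; simp [B, Set.MapsTo]
    rw [this]
    exact ContinuousMap.isOpen_setOfPred_mapsTo isCompact_univ isOpen_Ioi
  -- a nonpositive value of each finite sum excludes strictly positive convex combinations
  have hdisj : Disjoint B (convexHull ℝ A) := by
    rw [Set.disjoint_left]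
    intro h hB hA
    obtain ⟨ι, _, w, z, hw, -, hz, rfl⟩ := mem_convexHull_iff_exists_fintype.1 hA
    let e := Fintype.equivFin ι
    obtain ⟨k, hk⟩ := hsum _ (fun i => w (e.symm i) • z (e.symm i)) fun i =>
      hsmul _ (hz _) _ (hw _)
    refine (hB k).not_ge ?_
    rw [ContinuousMap.sum_apply]
    exact (e.symm.sum_comp fun i => (w i • z i) k).symm.trans_le hk
  obtain ⟨Λ, u, hΛB, hΛA⟩ :=
    geometric_hahn_banach_open hBconv hBopen (convex_convexHull ℝ A) hdisj
  have hu : u ≤ 0 := by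
    obtain ⟨g, hg⟩ := h0
    simpa using hΛA _ (subset_convexHull ℝ A (hsmul g hg 0 le_rfl))
  have hneg : ∀ g : C(K, ℝ), 0 ≤ g → Λ g ≤ 0 := by
    intro g hg
    -- `g + ε` is strictly positive for each `ε > 0`
    have hε : ∀ ε : ℝ, 0 < ε → Λ g + ε * Λ 1 ≤ 0 := fun ε hε => by
      have := (hΛB (g + ε • 1) fun k => by
        simpa using add_pos_of_nonneg_of_pos (hg k) hε).le.trans hu
      simpa using this
    have ht : Filter.Tendsto (fun ε : ℝ => Λ g + ε * Λ 1) (nhdsWithin 0 (Set.Ioi 0))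
        (nhds (Λ g + 0 * Λ 1)) :=
      (Continuous.tendsto (by fun_prop) 0).mono_left nhdsWithin_le_nhds
    have := le_of_tendsto ht (Filter.eventually_of_mem self_mem_nhdsWithin hε)
    simpa using this
  have h1 : Λ 1 < 0 := (hΛB 1 fun k => by simp).trans_le hu
  have hu0 : 0 ≤ u := by
    by_contra hlt
    rw [not_le] at hlt
    have := hΛB ((u / Λ 1) • 1) fun k => by simpa using div_pos_of_neg_of_neg hlt h1
    rw [map_smul, smul_eq_mul, div_mul_cancel₀ _ h1.ne] at this
    exact this.false
  obtain ⟨μ, hreg, hfin, hμ⟩ := exists_measure_of_functional ((Λ 1)⁻¹ • Λ.toLinearMap)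
    fun g hg => mul_nonneg_of_nonpos_of_nonpos (inv_nonpos.2 h1.le) (hneg g hg)
  refine ⟨μ, ?_, hreg, fun g hg => ?_⟩
  · have := hμ 1
    simp only [ContinuousMap.one_apply, integral_const, smul_eq_mul, mul_one,
      LinearMap.smul_apply, ContinuousLinearMap.coe_coe, inv_mul_cancel₀ h1.ne] at this
    exact ⟨by simpa [Measure.real, ENNReal.toReal_eq_one_iff] using this⟩
  · rw [hμ]
    exact mul_nonpos_of_nonpos_of_nonneg (inv_nonpos.2 h1.le)
      (hu0.trans (hΛA g (subset_convexHull ℝ A hg)))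

end Minimax

/-! ### The equivalences -/

section Equivalences

variable {𝕜 : Type*} [RCLike 𝕜] {X : Type*} [MetricSpace X] {x₀ : X}
  {E : Type*} [NormedAddCommGroup E] [NormedSpace 𝕜 E] {p : ℝ≥0∞}

/-- By compactness of `B_{X^#}`, the supremum in the weak norm is attained. -/
theorem exists_weakNorm_eq (hp : 1 ≤ p) {n : ℕ} (m : Fin n → LipFree 𝕜 x₀) :
    ∃ f : LipBall 𝕜 x₀, weakNorm 𝕜 p m = strongNorm p fun i => ClosedSpan.incl (m i) f.1 := by
  have hc : Continuous fun f : LipBall 𝕜 x₀ => strongNorm p fun i => ClosedSpan.incl (m i) f.1 :=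
    (continuous_strongNorm hp).comp (continuous_pi fun i => continuous_lipBall_incl (m i))
  obtain ⟨f, -, hf⟩ := isCompact_univ.exists_isMaxOn Set.univ_nonempty hc.continuousOn
  have hf' : ∀ g : LipBall 𝕜 x₀, strongNorm p (fun i => ClosedSpan.incl (m i) g.1) ≤
      strongNorm p fun i => ClosedSpan.incl (m i) f.1 := fun g => hf (Set.mem_univ g)
  refine ⟨f, ?_⟩
  rw [weakNorm_eq_iSup_lipBall]
  exact le_antisymm (ciSup_le hf') (le_ciSup (f := fun g : LipBall 𝕜 x₀ =>
    strongNorm p fun i => ClosedSpan.incl (m i) g.1) ⟨_, Set.forall_mem_range.2 hf'⟩ f)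

theorem strongNorm_incl_le_weakNorm (hp : 1 ≤ p) {n : ℕ} (m : Fin n → LipFree 𝕜 x₀)
    (f : LipBall 𝕜 x₀) :
    strongNorm p (fun i => ClosedSpan.incl (m i) f.1) ≤ weakNorm 𝕜 p m :=
  le_weakNorm hp m (φ := lipEval f.1) ((norm_lipEval_le f.1).trans f.2)

theorem incl_sum_smul_freeDelta {n : ℕ} (x y : Fin n → X) (c : Fin n → 𝕜) (f : LipZero 𝕜 x₀ 𝕜) :
    ClosedSpan.incl (∑ j, c j • freeDelta 𝕜 x₀ (x j) (y j)) f =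
      ∑ j, c j * (f (x j) - f (y j)) := by
  rw [← lipEval_apply, map_sum]
  exact Finset.sum_congr rfl fun j _ => by rw [map_smul]; rfl

theorem hasSummingInequality_iff_weakNorm (T : LipZero 𝕜 x₀ E) :
    HasSummingInequality p T ↔ ∃ C : ℝ, 0 < C ∧ ∀ (n₁ n₂ : ℕ) (x y : Fin n₁ → Fin n₂ → X)
      (c : Fin n₁ → Fin n₂ → 𝕜),
      strongNorm p (fun i => ∑ j, c i j • (T (x i j) - T (y i j))) ≤
        C * weakNorm 𝕜 p fun i => ∑ j, c i j • freeDelta 𝕜 x₀ (x i j) (y i j) := by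
  simp only [HasSummingInequality, weakNorm_eq_iSup_lipBall, incl_sum_smul_freeDelta]

/-- The pairing with `T`, seen as a map into `E**`, is evaluation of the functionals in `X ⊠ E*`. -/
theorem exists_bidual_pairing (T : LipZero 𝕜 x₀ E) :
    ∃ g : LipZero 𝕜 x₀ (StrongDual 𝕜 (StrongDual 𝕜 E)), ∀ (x y : X) (s : StrongDual 𝕜 E),
      (box 𝕜 x₀ x y s).1 g = s (T x - T y) := by
  obtain ⟨K, hK⟩ := T.2.1
  refine ⟨⟨fun x => NormedSpace.inclusionInDoubleDualLi 𝕜 (E := E) (T x),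
    ⟨⟨_, (NormedSpace.inclusionInDoubleDualLi 𝕜 (E := E)).lipschitz.comp hK⟩,
      by
        beta_reduce
        rw [LipZero.map_base]
        exact (NormedSpace.inclusionInDoubleDualLi 𝕜 (E := E)).toLinearMap.map_zero⟩⟩,
    fun x y s => (map_sub s _ _).symm⟩

/-- Absorbing scalars into the second factor, every `∑ m_i ⊗ s_i` with `m_i` in the span of the
`δ_(x,y)` represents an element of `X ⊠ E`. -/
theorem sum_tmul_mem_tensorsOver {n l : ℕ} (x y : Fin n → Fin l → X) (c : Fin n → Fin l → 𝕜)
    (s : Fin n → E) :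
    ∑ i, (∑ j, c i j • freeDelta 𝕜 x₀ (x i j) (y i j)) ⊗ₜ[𝕜] s i ∈
      tensorsOver (∑ k : Fin (n * l), box 𝕜 x₀
        (x (finProdFinEquiv.symm k).1 (finProdFinEquiv.symm k).2)
        (y (finProdFinEquiv.symm k).1 (finProdFinEquiv.symm k).2)
        (c (finProdFinEquiv.symm k).1 (finProdFinEquiv.symm k).2 •
          s (finProdFinEquiv.symm k).1)) := by
  refine ⟨n * l, _, _, _, rfl, ?_⟩
  rw [finProdFinEquiv.symm.sum_comp fun k : Fin n × Fin l =>
    freeDelta 𝕜 x₀ (x k.1 k.2) (y k.1 k.2) ⊗ₜ[𝕜] (c k.1 k.2 • s k.1), Fintype.sum_prod_type]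
  refine Finset.sum_congr rfl fun i _ => ?_
  rw [TensorProduct.sum_tmul]
  exact Finset.sum_congr rfl fun j _ => by rw [TensorProduct.smul_tmul]

theorem bddBelow_dL (hp : 1 ≤ p) (u : lipTensor 𝕜 x₀ E) :
    BddBelow {r | ∃ (n : ℕ) (m : Fin n → LipFree 𝕜 x₀) (e : Fin n → E),
      ∑ i, m i ⊗ₜ[𝕜] e i ∈ tensorsOver u ∧
        r = weakNorm 𝕜 p m * strongNorm (ENNReal.conjExponent p) e} := by
  refine ⟨0, ?_⟩
  rintro _ ⟨n, m, e, -, rfl⟩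
  exact mul_nonneg (weakNorm_nonneg hp m)
    (strongNorm_nonneg (by rw [ENNReal.conjExponent]; exact le_self_add) e)

theorem IsStrictlyLipschitzSumming.hasSummingInequality (hp : 1 ≤ p) {T : LipZero 𝕜 x₀ E}
    (h : IsStrictlyLipschitzSumming p T) : HasSummingInequality p T := by
  obtain ⟨C, hC, h⟩ := h
  refine (hasSummingInequality_iff_weakNorm T).2 ⟨C, hC, fun n l x y c => ?_⟩
  obtain ⟨s, hs, hsv⟩ :=
    exists_norming_family 𝕜 hp fun i => ∑ j, c i j • (T (x i j) - T (y i j))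
  have key := h (n * l) _ _ _ |>.trans <| mul_le_mul_of_nonneg_left
    (csInf_le (bddBelow_dL hp _) ⟨n, _, s, sum_tmul_mem_tensorsOver x y c s, rfl⟩) hC.le
  have hsum : ∑ k : Fin (n * l), (c (finProdFinEquiv.symm k).1 (finProdFinEquiv.symm k).2 •
        s (finProdFinEquiv.symm k).1)
        (T (x (finProdFinEquiv.symm k).1 (finProdFinEquiv.symm k).2) -
          T (y (finProdFinEquiv.symm k).1 (finProdFinEquiv.symm k).2)) =
      ∑ i, s i (∑ j, c i j • (T (x i j) - T (y i j))) := by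
    rw [finProdFinEquiv.symm.sum_comp fun k : Fin n × Fin l =>
      (c k.1 k.2 • s k.1) (T (x k.1 k.2) - T (y k.1 k.2)), Fintype.sum_prod_type]
    refine Finset.sum_congr rfl fun i _ => ?_
    rw [map_sum]
    exact Finset.sum_congr rfl fun j _ => by rw [map_smul]; rfl
  rw [hsum, hsv, RCLike.norm_ofReal, abs_of_nonneg (strongNorm_nonneg hp _)] at key
  exact key.trans (mul_le_mul_of_nonneg_left
    (mul_le_of_le_one_right (weakNorm_nonneg hp _) hs) hC.le)

/-- Domination by an `L^p`-norm, `p < ∞`, in terms of real integrals. -/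
theorem enorm_le_eLpNorm_iff {K F : Type*} [TopologicalSpace K] [CompactSpace K]
    [MeasurableSpace K] [BorelSpace K] [NormedAddCommGroup F] {μ : Measure K}
    [IsFiniteMeasure μ] (hp : 1 ≤ p) (hp' : p ≠ ∞) {C : ℝ} (hC : 0 ≤ C) (v : F)
    {g : K → 𝕜} (hg : Continuous g) :
    ‖v‖ₑ ≤ ENNReal.ofReal C * eLpNorm g p μ ↔
      ‖v‖ ^ p.toReal ≤ C ^ p.toReal * ∫ k, ‖g k‖ ^ p.toReal ∂μ := by
  have hq := toReal_pos_of_one_le hp hp'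
  obtain ⟨M, hM⟩ := (isCompact_range hg).isBounded.exists_norm_le
  have hmem : MemLp g p μ := MemLp.of_bound hg.aestronglyMeasurable M
    (Filter.Eventually.of_forall fun k => hM _ ⟨k, rfl⟩)
  have hI : 0 ≤ ∫ k, ‖g k‖ ^ p.toReal ∂μ := integral_nonneg fun k => by positivity
  rw [hmem.eLpNorm_eq_integral_rpow_norm (zero_lt_one.trans_le hp).ne' hp',
    ← ENNReal.ofReal_mul hC, ← ofReal_norm, ENNReal.ofReal_le_ofReal_iff (by positivity),
    ← Real.rpow_le_rpow_iff (norm_nonneg v) (by positivity) hq,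
    Real.mul_rpow hC (by positivity), Real.rpow_inv_rpow hI hq.ne']

theorem IsDominated.hasSummingInequality (hp : 1 ≤ p) {T : LipZero 𝕜 x₀ E}
    (h : IsDominated p T) : HasSummingInequality p T := by
  obtain ⟨C, hC, μ, hμ, -, h⟩ := h
  refine (hasSummingInequality_iff_weakNorm T).2 ⟨C, hC, fun n l x y c => ?_⟩
  set m : Fin n → LipFree 𝕜 x₀ := fun i => ∑ j, c i j • freeDelta 𝕜 x₀ (x i j) (y i j) with hm
  set v : Fin n → E := fun i => ∑ j, c i j • (T (x i j) - T (y i j)) with hv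
  have hW := weakNorm_nonneg (𝕜 := 𝕜) hp m
  have hdom : ∀ i, ‖v i‖ₑ ≤
      ENNReal.ofReal C * eLpNorm (fun f : LipBall 𝕜 x₀ => ClosedSpan.incl (m i) f.1) p μ := by
    intro i
    simp only [hm, hv, incl_sum_smul_freeDelta]
    exact h l (x i) (y i) (c i)
  rcases eq_or_ne p ∞ with rfl | hp'
  · rw [strongNorm_top]
    refine (pi_norm_le_iff_of_nonneg (by positivity)).2 fun i => ?_
    have hle : eLpNorm (fun f : LipBall 𝕜 x₀ => ClosedSpan.incl (m i) f.1) ∞ μ ≤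
        ENNReal.ofReal (weakNorm 𝕜 ∞ m) := by
      rw [eLpNorm_exponent_top]
      refine eLpNormEssSup_le_of_ae_bound (Filter.Eventually.of_forall fun f => ?_)
      refine le_trans ?_ (strongNorm_incl_le_weakNorm hp m f)
      rw [strongNorm_top]
      exact norm_le_pi_norm (fun i => ClosedSpan.incl (m i) f.1) i
    have := (hdom i).trans (mul_le_mul_right hle _)
    rwa [← ENNReal.ofReal_mul hC.le, ← ofReal_norm,
      ENNReal.ofReal_le_ofReal_iff (by positivity)] at this
  · have hq := toReal_pos_of_one_le hp hp'
    have hcont : ∀ i, Continuous fun f : LipBall 𝕜 x₀ => ‖ClosedSpan.incl (m i) f.1‖ ^ p.toReal :=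
      fun i => (continuous_lipBall_incl (m i)).norm.rpow_const fun _ => Or.inr hq.le
    have hint : ∀ i, Integrable
        (fun f : LipBall 𝕜 x₀ => ‖ClosedSpan.incl (m i) f.1‖ ^ p.toReal) μ :=
      fun i => (hcont i).integrable_of_hasCompactSupport (HasCompactSupport.of_compactSpace _)
    have hpt : ∀ f : LipBall 𝕜 x₀,
        ∑ i, ‖ClosedSpan.incl (m i) f.1‖ ^ p.toReal ≤ weakNorm 𝕜 p m ^ p.toReal := by
      intro f
      have := strongNorm_incl_le_weakNorm hp m f
      rwa [strongNorm_eq_sum hq, one_div,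
        Real.rpow_inv_le_iff_of_pos (by positivity) hW hq] at this
    rw [strongNorm_eq_sum hq, one_div,
      Real.rpow_inv_le_iff_of_pos (by positivity) (by positivity) hq, Real.mul_rpow hC.le hW]
    calc ∑ i, ‖v i‖ ^ p.toReal
        ≤ ∑ i, C ^ p.toReal * ∫ f, ‖ClosedSpan.incl (m i) f.1‖ ^ p.toReal ∂μ :=
          Finset.sum_le_sum fun i _ =>
            (enorm_le_eLpNorm_iff hp hp' hC.le _ (continuous_lipBall_incl (m i))).1 (hdom i)
      _ = C ^ p.toReal * ∫ f, ∑ i, ‖ClosedSpan.incl (m i) f.1‖ ^ p.toReal ∂μ := by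
          rw [integral_finsetSum _ fun i _ => hint i, Finset.mul_sum]
      _ ≤ C ^ p.toReal * ∫ _, weakNorm 𝕜 p m ^ p.toReal ∂μ := by
          gcongr
          · exact integrable_finsetSum _ fun i _ => hint i
          · exact integrable_const _
          · exact fun f => hpt f
      _ = C ^ p.toReal * weakNorm 𝕜 p m ^ p.toReal := by simp

variable [CompleteSpace E]

theorem linearization_freeDelta (T : LipZero 𝕜 x₀ E) (x y : X) :
    linearization T (freeDelta 𝕜 x₀ x y) = T x - T y := by
  rw [freeDelta_eq, map_sub, linearization_apply, linearization_apply]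

theorem linearization_sum_smul (T : LipZero 𝕜 x₀ E) {n : ℕ} (x y : Fin n → X) (c : Fin n → 𝕜) :
    linearization T (∑ j, c j • freeDelta 𝕜 x₀ (x j) (y j)) = ∑ j, c j • (T (x j) - T (y j)) := by
  simp only [map_sum, map_smul, linearization_freeDelta]

theorem IsSumming.isStrictlyLipschitzSumming (hp : 1 ≤ p) {T : LipZero 𝕜 x₀ E}
    (h : IsSumming p (linearization T)) : IsStrictlyLipschitzSumming p T := by
  obtain ⟨C, hC, h⟩ := h
  refine ⟨C, hC, fun l x y s => ?_⟩
  rw [mul_comm, ← div_le_iff₀ hC]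
  refine le_csInf ⟨_, l, fun k => freeDelta 𝕜 x₀ (x k) (y k), s, ⟨l, x, y, s, rfl, rfl⟩, rfl⟩ ?_
  rintro _ ⟨n, m, e, ⟨l', x', y', s', hu, hv⟩, rfl⟩
  rw [div_le_iff₀ hC]
  let Φ : LipFree 𝕜 x₀ ⊗[𝕜] StrongDual 𝕜 E →ₗ[𝕜] 𝕜 := TensorProduct.lift
    (LinearMap.mk₂ 𝕜 (fun m s => s (linearization T m)) (by simp) (by simp) (by simp) (by simp))
  have hΦ : ∀ m s, Φ (m ⊗ₜ s) = s (linearization T m) := fun m s => rfl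
  -- the value of the pairing depends only on the functional `u`, as `T` maps into `E**`
  obtain ⟨g, hg⟩ := exists_bidual_pairing T
  have h1 : ∑ k, s k (T (x k) - T (y k)) = ∑ k, s' k (T (x' k) - T (y' k)) := by
    have := congrArg (fun u : lipTensor 𝕜 x₀ (StrongDual 𝕜 E) => u.1 g) hu
    simpa only [AddSubmonoidClass.coe_finsetSum, LinearMap.sum_apply, hg] using this
  have h2 : ∑ i, e i (linearization T (m i)) = ∑ k, s' k (T (x' k) - T (y' k)) := by
    have := congrArg Φ hv
    simpa only [map_sum, hΦ, linearization_freeDelta] using this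
  rw [h1, ← h2]
  calc _ ≤ strongNorm p (fun i => linearization T (m i)) *
        strongNorm (ENNReal.conjExponent p) e := norm_sum_apply_le hp e _
    _ ≤ (C * weakNorm 𝕜 p m) * strongNorm (ENNReal.conjExponent p) e := by
        gcongr
        · exact strongNorm_nonneg (by rw [ENNReal.conjExponent]; exact le_self_add) e
        · exact h n m
    _ = _ := by ring

theorem HasSummingInequality.isSumming (hp : 1 ≤ p) {T : LipZero 𝕜 x₀ E}
    (h : HasSummingInequality p T) : IsSumming p (linearization T) := by
  obtain ⟨C, hC, h⟩ := (hasSummingInequality_iff_weakNorm T).1 h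
  refine isSumming_of_dense hp _ (dense_span_freeDelta 𝕜 x₀) hC fun n m hm => ?_
  obtain ⟨l, x, y, c, hc⟩ := exists_common_family hm
  have := h n l (fun _ => x) (fun _ => y) c
  simpa only [hc, linearization_sum_smul, ← funext hc] using this

theorem isDominated_of_linearization {T : LipZero 𝕜 x₀ E} {C : ℝ} (hC : 0 < C)
    {μ : Measure (LipBall 𝕜 x₀)} (hμ : IsProbabilityMeasure μ) (hreg : μ.Regular)
    (h : ∀ m, ‖linearization T m‖ₑ ≤
      ENNReal.ofReal C * eLpNorm (fun f : LipBall 𝕜 x₀ => ClosedSpan.incl m f.1) p μ) :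
    IsDominated p T := by
  refine ⟨C, hC, μ, hμ, hreg, fun n x y c => ?_⟩
  have := h (∑ j, c j • freeDelta 𝕜 x₀ (x j) (y j))
  simpa only [linearization_sum_smul, incl_sum_smul_freeDelta] using this

/-- Pietsch's domination theorem, for the norming set `B_{X^#}` of `F(X)`. -/
theorem IsSumming.isDominated_of_ne_top (hp : 1 ≤ p) (hp' : p ≠ ∞) {T : LipZero 𝕜 x₀ E}
    (h : IsSumming p (linearization T)) : IsDominated p T := by
  obtain ⟨C, hC, h⟩ := h
  have hq := toReal_pos_of_one_le hp hp'
  set q := p.toReal with hqdef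
  have hcont : ∀ m : LipFree 𝕜 x₀, Continuous fun f : LipBall 𝕜 x₀ => ‖ClosedSpan.incl m f.1‖ ^ q :=
    fun m => (continuous_lipBall_incl m).norm.rpow_const fun _ => Or.inr hq.le
  let G : LipFree 𝕜 x₀ → C(LipBall 𝕜 x₀, ℝ) := fun m =>
    ⟨fun f => ‖linearization T m‖ ^ q - C ^ q * ‖ClosedSpan.incl m f.1‖ ^ q,
      continuous_const.sub (continuous_const.mul (hcont m))⟩
  obtain ⟨μ, hμ, hreg, hint⟩ := exists_probability_integral_nonpos (A := Set.range G)
    (Set.range_nonempty G)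
    (by
      rintro _ ⟨m, rfl⟩ t ht
      -- `‖·‖ ^ q` is homogeneous of degree `q`, so scaling `m` by `t ^ (1/q)` scales `G m` by `t`
      refine ⟨((t ^ q⁻¹ : ℝ) : 𝕜) • m, ?_⟩
      ext f
      have hr : 0 ≤ t ^ q⁻¹ := Real.rpow_nonneg ht _
      have hrq : (t ^ q⁻¹) ^ q = t := Real.rpow_inv_rpow ht hq.ne'
      have h1 : ‖linearization T (((t ^ q⁻¹ : ℝ) : 𝕜) • m)‖ ^ q =
          t * ‖linearization T m‖ ^ q := by
        rw [map_smul, norm_smul, RCLike.norm_ofReal, abs_of_nonneg hr,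
          Real.mul_rpow hr (norm_nonneg _), hrq]
      have h2 : ‖ClosedSpan.incl (((t ^ q⁻¹ : ℝ) : 𝕜) • m) f.1‖ ^ q =
          t * ‖ClosedSpan.incl m f.1‖ ^ q := by
        rw [← lipEval_apply, map_smul, norm_smul, RCLike.norm_ofReal, abs_of_nonneg hr,
          Real.mul_rpow hr (norm_nonneg _), hrq, lipEval_apply]
      change _ - C ^ q * _ = t * (_ - C ^ q * _)
      rw [h1, h2]
      ring)
    (by
      intro n g hg
      choose m hm using hg
      -- a point of `B_{X^#}` at which the weak norm is attained makes the sum nonpositive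
      obtain ⟨f, hf⟩ := exists_weakNorm_eq hp m
      refine ⟨f, ?_⟩
      have hsum := h n m
      rw [hf, strongNorm_eq_sum hq, strongNorm_eq_sum hq, ← hqdef, one_div,
        Real.rpow_inv_le_iff_of_pos (by positivity) (by positivity) hq,
        Real.mul_rpow hC.le (by positivity), Real.rpow_inv_rpow (by positivity) hq.ne',
        Finset.mul_sum] at hsum
      have hval : ∀ i, g i f =
          ‖linearization T (m i)‖ ^ q - C ^ q * ‖ClosedSpan.incl (m i) f.1‖ ^ q :=
        fun i => by rw [← hm i]; rfl
      simpa only [hval, Finset.sum_sub_distrib, sub_nonpos] using hsum)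
  refine isDominated_of_linearization hC hμ hreg fun m => ?_
  rw [enorm_le_eLpNorm_iff hp hp' hC.le _ (continuous_lipBall_incl m), ← hqdef]
  have hm := hint _ ⟨m, rfl⟩
  change ∫ f : LipBall 𝕜 x₀,
    (‖linearization T m‖ ^ q - C ^ q * ‖ClosedSpan.incl m f.1‖ ^ q) ∂μ ≤ 0 at hm
  rw [integral_sub (integrable_const _) (((hcont m).integrable_of_hasCompactSupport
    (HasCompactSupport.of_compactSpace _)).const_mul _), integral_const_mul] at hm
  simpa using hm

/-- For `p = ∞`, a probability that charges every point of a dense sequence of `B_{X^#}`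
dominates. -/
theorem IsSumming.isDominated_top [TopologicalSpace.SeparableSpace X] {T : LipZero 𝕜 x₀ E}
    (h : IsSumming ∞ (linearization T)) : IsDominated ∞ T := by
  obtain ⟨C, hC, h⟩ := h
  have := metrizableSpace_lipBall (𝕜 := 𝕜) (x₀ := x₀)
  let := TopologicalSpace.metrizableSpaceMetric (LipBall 𝕜 x₀)
  let d : ℕ → LipBall 𝕜 x₀ := TopologicalSpace.denseSeq _
  let μ : Measure (LipBall 𝕜 x₀) :=
    Measure.sum fun n => (2⁻¹ : ℝ≥0∞) ^ (n + 1) • Measure.dirac (d n)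
  have hμ : IsProbabilityMeasure μ := ⟨by
    simp only [μ, Measure.sum_apply _ MeasurableSet.univ, Measure.smul_apply, measure_univ,
      smul_eq_mul, mul_one]
    rw [ENNReal.tsum_geometric_add_one, ENNReal.one_sub_inv_two, inv_inv]
    exact ENNReal.inv_mul_cancel two_ne_zero ENNReal.ofNat_ne_top⟩
  refine isDominated_of_linearization hC hμ inferInstance fun m => ?_
  have hcont := continuous_lipBall_incl (𝕜 := 𝕜) (x₀ := x₀) m
  set g : LipBall 𝕜 x₀ → 𝕜 := fun f => ClosedSpan.incl m f.1
  have hd : ∀ n, ‖g (d n)‖ₑ ≤ eLpNorm g ∞ μ := by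
    intro n
    have hae : ∀ᵐ f ∂μ, ‖g f‖ₑ ≤ eLpNorm g ∞ μ := by
      rw [eLpNorm_exponent_top]
      exact ae_le_eLpNormEssSup
    have hn := (Measure.ae_sum_iff.1 hae) n
    rw [Measure.ae_ennreal_smul_measure_iff (by simp), ae_dirac_eq] at hn
    exact hn
  have hall : ∀ f, ‖g f‖ₑ ≤ eLpNorm g ∞ μ := isClosed_property
    (TopologicalSpace.denseRange_denseSeq _) (isClosed_le hcont.enorm continuous_const) hd
  obtain ⟨f, hf⟩ := exists_weakNorm_eq le_top fun _ : Fin 1 => m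
  have hm := h 1 fun _ => m
  rw [hf, strongNorm_fin_one le_top, strongNorm_fin_one le_top] at hm
  calc ‖linearization T m‖ₑ = ENNReal.ofReal ‖linearization T m‖ := (ofReal_norm _).symm
    _ ≤ ENNReal.ofReal (C * ‖g f‖) := ENNReal.ofReal_le_ofReal hm
    _ = ENNReal.ofReal C * ‖g f‖ₑ := by rw [ENNReal.ofReal_mul hC.le, ofReal_norm]
    _ ≤ _ := by gcongr; exact hall f

end Equivalences

end StrictLip

theorem theorem2p2 {𝕜 : Type*} [RCLike 𝕜] {X : Type*} [MetricSpace X] (x₀ : X)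
    {E : Type*} [NormedAddCommGroup E] [NormedSpace 𝕜 E] [CompleteSpace E]
    (p : ℝ≥0∞) (hp : 1 ≤ p) (T : StrictLip.LipZero 𝕜 x₀ E) :
    (p ≠ ∞ ∨ TopologicalSpace.SeparableSpace X →
      [StrictLip.IsStrictlyLipschitzSumming p T,
        StrictLip.IsSumming p (StrictLip.linearization T),
        StrictLip.IsDominated p T,
        StrictLip.HasSummingInequality p T].TFAE) ∧
    [StrictLip.IsStrictlyLipschitzSumming p T,
      StrictLip.IsSumming p (StrictLip.linearization T),
      StrictLip.HasSummingInequality p T].TFAE ∧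
    (StrictLip.IsDominated p T → StrictLip.IsStrictlyLipschitzSumming p T) := by
  have h21 : StrictLip.IsSumming p (StrictLip.linearization T) →
      StrictLip.IsStrictlyLipschitzSumming p T := fun h => h.isStrictlyLipschitzSumming hp
  have h14 : StrictLip.IsStrictlyLipschitzSumming p T → StrictLip.HasSummingInequality p T :=
    fun h => h.hasSummingInequality hp
  have h42 : StrictLip.HasSummingInequality p T →
      StrictLip.IsSumming p (StrictLip.linearization T) := fun h => h.isSumming hp
  have h34 : StrictLip.IsDominated p T → StrictLip.HasSummingInequality p T :=
    fun h => h.hasSummingInequality hp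
  refine ⟨fun hpX => ?_, ?_, fun h => h21 (h42 (h34 h))⟩
  · have h23 : StrictLip.IsSumming p (StrictLip.linearization T) → StrictLip.IsDominated p T := by
      intro h
      rcases eq_or_ne p ∞ with rfl | hp'
      · have : TopologicalSpace.SeparableSpace X := hpX.resolve_left (fun h => h rfl)
        exact h.isDominated_top
      · exact h.isDominated_of_ne_top hp hp'
    tfae_have 2 → 1 := h21
    tfae_have 1 → 4 := h14
    tfae_have 4 → 2 := h42
    tfae_have 3 → 4 := h34
    tfae_have 2 → 3 := h23
    tfae_finish
  · tfae_have 2 → 1 := h21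
    tfae_have 1 → 3 := h14
    tfae_have 3 → 2 := h42
    tfae_finish
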